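/- A $\Box$-set $X$ (pre-cubical set) consists of sets $X_n$ ($n\ge 0$) of $n$-cubes and face maps $d_i^{\alpha}\colon X_n\to X_{n-1}$ ($n\ge 1$, $1\le i\le n$, $\alpha\in\{0,1\}$) with $d_i^{\alpha}d_j^{\beta}=d_{j-1}^{\beta}d_i^{\alpha}$ for $i<j$; elements of $X_0$ are vertices. With $I=[0,1]$, its geometric realization $|X|$ is the quotient space of $\coprod_{n\ge 0}X_n\times I^n$ ($X_n$ discrete) by the equivalence relation generated by $(d_i^{\alpha}c,x)\sim(c,\delta_i^{\alpha}x)$, where $\delta_i^{\alpha}(x_1,\dots,x_{n-1})=(x_1,\dots,x_{i-1},\alpha,x_i,\dots,x_{n-1})$; the class of $(c,x)$ is written $[c;x]$. A continuous path $\beta$ from a closed interval to $I^n$ is increasing if every coordinate $\beta_i$ is non-decreasing, and strictly increasing if moreover $\beta_i(t)=\beta_i(t')$ implies $t=t'$ or $\beta_i(t)\in\{0,1\}$. A presentation of a continuous path $p\colon I\to|X|$ consists of numbers $0=t_0\le t_1\le\dots\le t_l=1$, cubes $c_1,\dots,c_l$ of $X$ and continuous increasing paths $\beta_i\colon[t_{i-1},t_i]\to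 I^{\dim c_i}$ such that $p(t)=[c_i;\beta_i(t)]$ for $t_{i-1}\le t\le t_i$. A path $p$ that has a presentation is a d-path; it is strict if it has a presentation in which all $\beta_i$ are strictly increasing, and tame if it has a presentation in which $p(t_i)$ is a vertex for every $0\le i\le l$. Let $X$ be an arbitrary $\Box$-set with selected vertices $x^-,x^+\in X_0$. Let $\vec{S}(X)_{x^-}^{x^+}$ be the space of strict d-paths $p$ with $p(0)=x^-$ and $p(1)=x^+$, and $\vec{ST}(X)_{x^-}^{x^+}$ its subspace of those that are also tame, both with the topology induced from the compact-open topology on $|X|^I$. Then the inclusion map $$\iota\colon\vec{ST}(X)_{x^-}^{x^+}\hookrightarrow\vec{S}(X)_{x^-}^{x^+}$$ is a homotopy equivalence. -/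

import Mathlib

open scoped unitInterval

universe u

/-- A `□`-set (pre-cubical set): sets of `n`-cubes with face maps `d_i^α`, where the coordinate `i`
is counted from `0` and `α = false, true` stands for `0, 1`. The axiom is
`d_i^α d_j^β = d_{j-1}^β d_i^α` for `i < j`, written with `j = k + 1`, `i ≤ k`. -/
structure BoxSet where
  /-- the `n`-cubes -/
  cube : ℕ → Type u
  /-- the face maps -/
  face : ∀ {n : ℕ}, Fin (n + 1) → Bool → cube (n + 1) → cube n
  face_face : ∀ {n : ℕ} (i k : Fin (n + 1)) (α β : Bool) (c : cube (n + 2)), i ≤ k →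
    face i α (face k.succ β c) = face k β (face i.castSucc α c)

namespace BoxSet

/-- The standard cube `I^n` with the product topology and the product order. -/
abbrev StdCube (n : ℕ) : Type := Fin n → I

/-- The end point `0` or `1` of `I` given by a sign. -/
def endpt (α : Bool) : I := if α then 1 else 0

/-- The coface map `δ_i^α : I^n → I^{n+1}`, inserting `α` as the coordinate number `i`. -/
def coface {n : ℕ} (i : Fin (n + 1)) (α : Bool) (x : StdCube n) : StdCube (n + 1) :=
  i.insertNth (α := fun _ => I) (endpt α) x

/-- The disjoint union of the standard cubes, one copy of `I^n` for every `n`-cube of `X`, with the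
disjoint union topology. -/
abbrev PreRealization (X : BoxSet.{u}) : Type u := Σ c : (Σ n : ℕ, X.cube n), StdCube c.1

/-- The elementary identifications `(d_i^α c, x) ∼ (c, δ_i^α x)`. -/
inductive Glue (X : BoxSet.{u}) : X.PreRealization → X.PreRealization → Prop
  | face {n : ℕ} (i : Fin (n + 1)) (α : Bool) (c : X.cube (n + 1)) (x : StdCube n) :
      Glue X ⟨⟨n, X.face i α c⟩, x⟩ ⟨⟨n + 1, c⟩, coface i α x⟩

/-- The geometric realization: the quotient space of the disjoint union of cubes by the equivalence
relation generated by the elementary identifications, with the quotient topology. -/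
abbrev Realization (X : BoxSet.{u}) : Type u := Quot X.Glue

/-- The quotient map `I^n → |X|`, `x ↦ [c; x]` of an `n`-cube `c`. -/
def toReal (X : BoxSet.{u}) {n : ℕ} (c : X.cube n) (x : StdCube n) : X.Realization :=
  Quot.mk X.Glue ⟨⟨n, c⟩, x⟩

/-- The point of the realization given by a vertex. -/
def vertexPt (X : BoxSet.{u}) (v : X.cube 0) : X.Realization := X.toReal v Fin.elim0

/-- A path `J → I^n` is increasing if all its coordinates are non-decreasing. -/
def Increasing {n : ℕ} {J : Set I} (b : C(J, StdCube n)) : Prop :=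
  ∀ i : Fin n, ∀ s t : J, s ≤ t → b s i ≤ b t i

/-- A path `J → I^n` is strictly increasing if it is increasing and a coordinate takes no value
other than `0` and `1` twice. -/
def StrictlyIncreasing {n : ℕ} {J : Set I} (b : C(J, StdCube n)) : Prop :=
  Increasing b ∧ ∀ i : Fin n, ∀ s t : J, b s i = b t i → s = t ∨ b s i = 0 ∨ b s i = 1

/-- A presentation `[c_1; β_1] *_{t_1} ⋯ *_{t_{l-1}} [c_l; β_l]` of a path `p` in `|X|`
by increasing paths `β_i` in cubes. -/
structure Presentation (X : BoxSet.{u}) (p : C(I, X.Realization)) where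
  /-- the number of segments -/
  len : ℕ
  /-- the subdivision of the unit interval -/
  time : Fin (len + 1) → I
  time_mono : Monotone time
  time_zero : time 0 = 0
  time_last : time (Fin.last len) = 1
  /-- the dimensions of the cubes -/
  dim : Fin len → ℕ
  /-- the cubes `c_i` -/
  cell : ∀ i : Fin len, X.cube (dim i)
  /-- the paths `β_i : [t_{i-1}, t_i] → I^{dim c_i}` -/
  seg : ∀ i : Fin len, C(Set.Icc (time i.castSucc) (time i.succ), StdCube (dim i))
  seg_increasing : ∀ i : Fin len, Increasing (seg i)
  eq_seg : ∀ (i : Fin len) (s : Set.Icc (time i.castSucc) (time i.succ)),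
    p s = X.toReal (cell i) (seg i s)

/-- A path is strictly directed if it has a presentation by strictly increasing paths. -/
def IsStrict (X : BoxSet.{u}) (p : C(I, X.Realization)) : Prop :=
  ∃ P : X.Presentation p, ∀ i : Fin P.len, StrictlyIncreasing (P.seg i)

/-- A d-path is tame if it has a presentation such that it is at a vertex at all the times of the
subdivision. -/
def IsTame (X : BoxSet.{u}) (p : C(I, X.Realization)) : Prop :=
  ∃ P : X.Presentation p, ∀ i : Fin (P.len + 1), ∃ v : X.cube 0, p (P.time i) = X.vertexPt v

/-- The strict d-paths from `x` to `y`, with the compact-open topology. -/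
def strictPaths (X : BoxSet.{u}) (x y : X.cube 0) : Set C(I, X.Realization) :=
  {p | X.IsStrict p ∧ p 0 = X.vertexPt x ∧ p 1 = X.vertexPt y}

/-- The strict tame d-paths from `x` to `y`, with the compact-open topology. -/
def strictTamePaths (X : BoxSet.{u}) (x y : X.cube 0) : Set C(I, X.Realization) :=
  {p | (X.IsStrict p ∧ X.IsTame p) ∧ p 0 = X.vertexPt x ∧ p 1 = X.vertexPt y}

theorem strictTamePaths_subset (X : BoxSet.{u}) (x y : X.cube 0) :
    X.strictTamePaths x y ⊆ X.strictPaths x y :=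
  fun _ hp => ⟨hp.1.1, hp.2⟩

/-- The inclusion of the space of strict tame d-paths into the space of strict d-paths. -/
def tameInclusion (X : BoxSet.{u}) (x y : X.cube 0) :
    C(X.strictTamePaths x y, X.strictPaths x y) :=
  ⟨Set.inclusion (X.strictTamePaths_subset x y), continuous_inclusion _⟩

end BoxSet

/-- A continuous map is a homotopy equivalence if it is the underlying map of one. -/
def IsHomotopyEquivalence {A B : Type*} [TopologicalSpace A] [TopologicalSpace B]
    (f : C(A, B)) : Prop :=
  ∃ e : ContinuousMap.HomotopyEquiv A B, e.toFun = f

/-!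
Stretch every coordinate of every cube linearly from the centre `1 / 2`, by a factor at least `1`,
and cut off at `0` and `1`. This fixes the end points of `I`, so it is compatible with the face
identifications and defines a flow on `|X|` that preserves strict paths and tame paths.

It remains to find, for a strict path `p`, a factor that makes `p` tame and depends continuously on
`p`. Along a short piece of `p` the sum of the coordinates rises by less than `1 / 4`. So a
coordinate that is `0` when the piece enters a cube is still at most `1 / 4` at its end, and
stretching by a factor at least `2` keeps it at `0` throughout: the stretched piece never leaves the
minimal cube of its starting point through a lower face, that is, it lifts to a single cube.
The sum of the coordinates is well defined on `|X|` modulo `1`, which is enough to measure small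
rises, and yields a modulus of continuity for the shortness of the pieces.

On the other hand each coordinate of a strict path passes through `1 / 2` at most once in each
segment, so `p` is off the centres at all but finitely many times, and at such times a large
factor pushes all coordinates to `0` or `1`, that is, the point to a vertex. The factor needed for
doing this at a sufficiently dense set of times is the inverse of a continuous positive function
of `p`, defined by a minimum and a maximum over `I`.
-/

theorem isHomotopyEquivalence_inclusion {Z : Type*} [TopologicalSpace Z] {A B : Set Z}
    (hAB : A ⊆ B) (H : C(I × B, B)) (hH₀ : ∀ b, H (0, b) = b) (hH₁ : ∀ b, (H (1, b) : Z) ∈ A)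
    (hHA : ∀ s (b : B), (b : Z) ∈ A → (H (s, b) : Z) ∈ A) :
    IsHomotopyEquivalence (⟨Set.inclusion hAB, continuous_inclusion hAB⟩ : C(A, B)) := by
  let incl : C(A, B) := ⟨Set.inclusion hAB, continuous_inclusion hAB⟩
  let retr : C(B, A) := ⟨fun b => ⟨H (1, b), hH₁ b⟩, by fun_prop⟩
  have hretr : (ContinuousMap.id A).Homotopic (retr.comp incl) :=
    ⟨{  toFun q := ⟨H (q.1, incl q.2), hHA q.1 (incl q.2) q.2.2⟩
        map_zero_left a := Subtype.ext <| show (H (0, incl a) : Z) = a by rw [hH₀]; rfl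
        map_one_left _ := rfl }⟩
  have hincl : (ContinuousMap.id B).Homotopic (incl.comp retr) :=
    ⟨{  toFun := H
        map_zero_left := hH₀
        map_one_left _ := rfl }⟩
  exact ⟨⟨incl, retr, hretr.symm, hincl.symm⟩, rfl⟩

section Compactness

variable {Y K : Type*} [TopologicalSpace Y] [TopologicalSpace K] [CompactSpace K]

theorem continuous_iInf_of_compactSpace {f : Y → K → ℝ}
    (hf : Continuous fun q : Y × K => f q.1 q.2) :
    Continuous fun y => ⨅ k, f y k := by
  simpa only [Set.image_univ, sInf_range] using isCompact_univ.continuous_sInf hf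

theorem continuous_iSup_of_compactSpace {f : Y → K → ℝ}
    (hf : Continuous fun q : Y × K => f q.1 q.2) :
    Continuous fun y => ⨆ k, f y k := by
  simpa only [Set.image_univ, sSup_range] using isCompact_univ.continuous_sSup hf

theorem exists_eq_iInf_of_compactSpace [Nonempty K] {f : K → ℝ} (hf : Continuous f) :
    ∃ k, f k = ⨅ k, f k :=
  (isCompact_range hf).sInf_mem (Set.range_nonempty f)

theorem exists_eq_iSup_of_compactSpace [Nonempty K] {f : K → ℝ} (hf : Continuous f) :
    ∃ k, f k = ⨆ k, f k :=
  (isCompact_range hf).sSup_mem (Set.range_nonempty f)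

end Compactness

theorem lt_of_norm_coe_lt_of_isPreconnected {α : Type*} [TopologicalSpace α] {S : Set α}
    (hS : IsPreconnected S) {φ : α → ℝ} (hφ : ContinuousOn φ S) {ε : ℝ} (hε : ε ≤ 1 / 2)
    (h : ∀ u ∈ S, ‖(φ u : UnitAddCircle)‖ < ε) {s t : α} (hs : s ∈ S) (ht : t ∈ S)
    (hφs : φ s < ε) : φ t < ε := by
  by_contra! hφt
  obtain ⟨u, hu, rfl⟩ := hS.intermediate_value hs ht hφ ⟨hφs.le, hφt⟩
  have hpos : 0 ≤ φ u := (norm_nonneg _).trans (h u hu).le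
  have hnorm : ‖(φ u : UnitAddCircle)‖ = |φ u| :=
    (AddCircle.norm_coe_eq_abs_iff 1 one_ne_zero).2 (by simpa [abs_of_nonneg hpos] using hε)
  have := h u hu
  rw [hnorm, abs_of_nonneg hpos] at this
  exact this.false

theorem exists_relSeries_of_reflTransGen {α : Type*} {r : α → α → Prop} {a b : α}
    (h : Relation.ReflTransGen r a b) :
    ∃ τ : RelSeries {q : α × α | r q.1 q.2}, τ.head = a ∧ τ.last = b := by
  obtain ⟨l, hl, rfl⟩ := List.exists_isChain_cons_of_relationReflTransGen h
  refine ⟨.fromListIsChain (a :: l) (List.cons_ne_nil _ _) hl, by simp, ?_⟩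
  simp [← RelSeries.getLast_toList]

theorem reflTransGen_one_of_step {r : I → I → Prop} {δ : ℝ} (hδ : 0 < δ)
    (hr : ∀ s, r s 1 ∨ ∃ t : I, (s : ℝ) + δ ≤ t ∧ r s t) (s : I) : Relation.ReflTransGen r s 1 := by
  obtain ⟨n, hn⟩ := Archimedean.arch (1 - s : ℝ) hδ
  induction n generalizing s with
  | zero =>
    have hs : (1 : ℝ) ≤ s := by simpa only [zero_smul, sub_nonpos] using hn
    obtain rfl : s = 1 := le_antisymm s.2.2 hs
    exact .refl
  | succ n ih =>
    rcases hr s with hs | ⟨t, hst, hs⟩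
    · exact .single hs
    · refine .head hs (ih t ?_)
      rw [succ_nsmul] at hn
      linarith

namespace BoxSet

variable {X : BoxSet.{u}}

/-! ### The stretching flow -/

/-- The linear map stretching the interval from its centre by the factor `max 1 r`, cut off at the
end points. Factors `r ≤ 1` are allowed, and act as the identity, so that the end points are fixed
for all real `r`. -/
noncomputable def stretch (r : ℝ) (x : I) : I :=
  Set.projIcc 0 1 zero_le_one (1 / 2 + max 1 r * (x - 1 / 2))

@[fun_prop]
theorem continuous_stretch : Continuous fun q : ℝ × I => stretch q.1 q.2 := by
  unfold stretch
  fun_prop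

theorem monotone_stretch (r : ℝ) : Monotone (stretch r) := by
  intro x y h
  refine Set.monotone_projIcc _ ?_
  have : (x : ℝ) ≤ y := h
  gcongr

theorem stretch_of_le_one {r : ℝ} (hr : r ≤ 1) (x : I) : stretch r x = x := by
  simp [stretch, max_eq_left hr]

theorem stretch_inv_eq_zero_iff {w : ℝ} (hw₀ : 0 < w) (hw₁ : w ≤ 1) {x : I} :
    stretch w⁻¹ x = 0 ↔ 2 * (x : ℝ) ≤ 1 - w := by
  refine (Set.projIcc_eq_left zero_lt_one).trans ?_
  rw [max_eq_right ((one_le_inv₀ hw₀).2 hw₁), inv_mul_eq_div, ← le_neg_iff_add_nonpos_left,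
    div_le_iff₀ hw₀]
  constructor <;> intro h <;> linarith

theorem stretch_inv_eq_one_iff {w : ℝ} (hw₀ : 0 < w) (hw₁ : w ≤ 1) {x : I} :
    stretch w⁻¹ x = 1 ↔ 1 + w ≤ 2 * (x : ℝ) := by
  refine (Set.projIcc_eq_right zero_lt_one).trans ?_
  rw [max_eq_right ((one_le_inv₀ hw₀).2 hw₁), inv_mul_eq_div, ← sub_le_iff_le_add',
    le_div_iff₀ hw₀]
  constructor <;> intro h <;> linarith

@[simp] theorem stretch_zero (r : ℝ) : stretch r 0 = 0 := by
  refine Set.projIcc_of_le_left _ ?_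
  have := le_max_left 1 r
  simp only [Set.Icc.coe_zero]
  linarith

@[simp] theorem stretch_one (r : ℝ) : stretch r 1 = 1 := by
  refine Set.projIcc_of_right_le _ ?_
  have := le_max_left 1 r
  simp only [Set.Icc.coe_one]
  linarith

theorem coe_stretch {r : ℝ} {x : I} (h₀ : stretch r x ≠ 0) (h₁ : stretch r x ≠ 1) :
    (stretch r x : ℝ) = 1 / 2 + max 1 r * (x - 1 / 2) := by
  have hpos : 0 ≤ 1 / 2 + max 1 r * ((x : ℝ) - 1 / 2) := by
    by_contra! h
    exact h₀ (Set.projIcc_of_le_left _ h.le)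
  have hle : 1 / 2 + max 1 r * ((x : ℝ) - 1 / 2) ≤ 1 := by
    by_contra! h
    exact h₁ (Set.projIcc_of_right_le _ h.le)
  rw [stretch, Set.projIcc_of_mem _ ⟨hpos, hle⟩]

theorem eq_or_eq_zero_or_eq_one_of_stretch_eq {r : ℝ} {x y : I} (h : stretch r x = stretch r y) :
    x = y ∨ stretch r x = 0 ∨ stretch r x = 1 := by
  by_contra! ⟨hxy, h₀, h₁⟩
  have hcoe := congrArg Subtype.val h
  rw [coe_stretch h₀ h₁, coe_stretch (h ▸ h₀) (h ▸ h₁), add_right_inj] at hcoe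
  exact hxy (Subtype.ext (sub_left_injective (mul_left_cancel₀ (by positivity) hcoe)))

theorem stretch_div_stretch {q r : ℝ} (hq : 1 ≤ q) (hqr : q ≤ r) (x : I) :
    stretch (r / q) (stretch q x) = stretch r x := by
  have hq₀ : 0 < q := zero_lt_one.trans_le hq
  have hrq : 1 ≤ r / q := (one_le_div hq₀).2 hqr
  by_cases h₀ : stretch q x = 0
  · have := (stretch_inv_eq_zero_iff (inv_pos.2 hq₀) (inv_le_one_of_one_le₀ hq)).1
      (by rwa [inv_inv])
    rw [h₀, stretch_zero, eq_comm, ← inv_inv r,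
      stretch_inv_eq_zero_iff (inv_pos.2 (hq₀.trans_le hqr)) (inv_le_one_of_one_le₀ (hq.trans hqr))]
    linarith [inv_anti₀ hq₀ hqr]
  by_cases h₁ : stretch q x = 1
  · have := (stretch_inv_eq_one_iff (inv_pos.2 hq₀) (inv_le_one_of_one_le₀ hq)).1
      (by rwa [inv_inv])
    rw [h₁, stretch_one, eq_comm, ← inv_inv r,
      stretch_inv_eq_one_iff (inv_pos.2 (hq₀.trans_le hqr)) (inv_le_one_of_one_le₀ (hq.trans hqr))]
    linarith [inv_anti₀ hq₀ hqr]
  have hcoe := coe_stretch h₀ h₁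
  rw [max_eq_right hq] at hcoe
  rw [stretch, hcoe, stretch, max_eq_right hrq, max_eq_right (hq.trans hqr), add_sub_cancel_left,
    ← mul_assoc, div_mul_cancel₀ _ hq₀.ne']

/-! ### Transport along the identifications of the realization -/

@[simp] theorem coface_same {n : ℕ} (i : Fin (n + 1)) (α : Bool) (x : StdCube n) :
    coface i α x i = endpt α := by simp [coface]

@[simp] theorem coface_succAbove {n : ℕ} (i : Fin (n + 1)) (α : Bool) (x : StdCube n)
    (j : Fin n) : coface i α x (i.succAbove j) = x j := by simp [coface]

theorem coface_eq_iff {n : ℕ} (i : Fin (n + 1)) (α : Bool) (x : StdCube n)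
    (y : StdCube (n + 1)) :
    coface i α x = y ↔ endpt α = y i ∧ ∀ j, x j = y (i.succAbove j) := by
  refine ⟨fun h => h ▸ by simp, fun ⟨h₁, h₂⟩ => funext fun j => ?_⟩
  induction j using Fin.succAboveCases i with
  | x => simpa using h₁
  | p j => simpa using h₂ j

theorem continuous_coface {n : ℕ} (i : Fin (n + 1)) (α : Bool) :
    Continuous (coface (n := n) i α) := by
  refine continuous_pi fun j => ?_
  induction j using Fin.succAboveCases i with
  | x => simpa using continuous_const
  | p j => simpa using continuous_apply j

theorem monotone_coface {n : ℕ} (i : Fin (n + 1)) (α : Bool) :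
    Monotone (coface (n := n) i α) := by
  intro x y h j
  induction j using Fin.succAboveCases i with
  | x => simp
  | p j => simpa using h j

theorem map_endpt {f : I → I} (h₀ : f 0 = 0) (h₁ : f 1 = 1) (α : Bool) :
    f (endpt α) = endpt α := by
  cases α <;> simp [endpt, h₀, h₁]

theorem coface_comp {f : I → I} (h₀ : f 0 = 0) (h₁ : f 1 = 1) {n : ℕ} (i : Fin (n + 1))
    (α : Bool) (x : StdCube n) : coface i α (f ∘ x) = f ∘ coface i α x := by
  simp [coface_eq_iff, map_endpt h₀ h₁]

theorem toReal_face {n : ℕ} (i : Fin (n + 1)) (α : Bool) (c : X.cube (n + 1)) (x : StdCube n) :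
    X.toReal (X.face i α c) x = X.toReal c (coface i α x) :=
  Quot.sound (Glue.face i α c x)

theorem exists_toReal_eq (x : X.Realization) :
    ∃ (n : ℕ) (c : X.cube n) (y : StdCube n), X.toReal c y = x := by
  obtain ⟨a, rfl⟩ := Quot.exists_rep x
  exact ⟨a.1.1, a.1.2, a.2, rfl⟩

theorem continuous_toReal {n : ℕ} (c : X.cube n) : Continuous (X.toReal c) :=
  continuous_quot_mk.comp (@continuous_sigmaMk _ (fun c : (Σ n, X.cube n) => StdCube c.1) _ ⟨n, c⟩)

/-- The smallest closed face of the standard cube that contains `x`. -/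
def minimalFace {n : ℕ} (x : StdCube n) : Set (StdCube n) :=
  {z | ∀ j, (x j = 0 → z j = 0) ∧ (x j = 1 → z j = 1)}

theorem eq_endpt_of_mem_minimalFace {n : ℕ} {x z : StdCube n} (h : z ∈ minimalFace x) {j : Fin n}
    {α : Bool} (hx : x j = endpt α) : z j = endpt α := by
  cases α
  · exact (h j).1 hx
  · exact (h j).2 hx

/-- The map `φ` between standard cubes transports the minimal face of the point `a` of a cube of `X`
to that of the point `b`, without changing the image in the realization. It is
monotone and commutes with coordinatewise maps, so that it transports directed paths in
the minimal face and their stretchings as well. -/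
structure IsFaceTransport (a b : X.PreRealization) (φ : StdCube a.1.1 → StdCube b.1.1) :
    Prop where
  continuous : Continuous φ
  monotone : Monotone φ
  map_point : φ a.2 = b.2
  map_comp : ∀ f : I → I, f 0 = 0 → f 1 = 1 → ∀ z, φ (f ∘ z) = f ∘ φ z
  mapsTo : Set.MapsTo φ (minimalFace a.2) (minimalFace b.2)
  toReal_eq : ∀ z ∈ minimalFace a.2, X.toReal a.1.2 z = X.toReal b.1.2 (φ z)

theorem IsFaceTransport.refl (a : X.PreRealization) : IsFaceTransport a a id where
  continuous := continuous_id
  monotone := monotone_id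
  map_point := rfl
  map_comp _ _ _ _ := rfl
  mapsTo := Set.mapsTo_id _
  toReal_eq _ _ := rfl

theorem IsFaceTransport.comp {a b c : X.PreRealization} {φ : StdCube a.1.1 → StdCube b.1.1}
    {ψ : StdCube b.1.1 → StdCube c.1.1} (hψ : IsFaceTransport b c ψ) (hφ : IsFaceTransport a b φ) :
    IsFaceTransport a c (ψ ∘ φ) where
  continuous := hψ.continuous.comp hφ.continuous
  monotone := hψ.monotone.comp hφ.monotone
  map_point := by rw [Function.comp_apply, hφ.map_point, hψ.map_point]
  map_comp f h₀ h₁ z := by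
    simp only [Function.comp_apply, hφ.map_comp f h₀ h₁, hψ.map_comp f h₀ h₁]
  mapsTo := hψ.mapsTo.comp hφ.mapsTo
  toReal_eq z hz := (hφ.toReal_eq z hz).trans (hψ.toReal_eq _ (hφ.mapsTo hz))

theorem isFaceTransport_coface {n : ℕ} (i : Fin (n + 1)) (α : Bool) (c : X.cube (n + 1))
    (x : StdCube n) : IsFaceTransport (X := X) ⟨⟨n, X.face i α c⟩, x⟩ ⟨⟨n + 1, c⟩, coface i α x⟩
      (coface i α) where
  continuous := continuous_coface i α
  monotone := monotone_coface i α
  map_point := rfl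
  map_comp _ h₀ h₁ z := coface_comp h₀ h₁ i α z
  mapsTo z hz j := by
    induction j using Fin.succAboveCases i with
    | x => simp
    | p j => simpa using hz j
  toReal_eq z _ := toReal_face i α c z

theorem isFaceTransport_removeNth {n : ℕ} (i : Fin (n + 1)) (α : Bool) (c : X.cube (n + 1))
    (x : StdCube n) : IsFaceTransport (X := X) ⟨⟨n + 1, c⟩, coface i α x⟩ ⟨⟨n, X.face i α c⟩, x⟩
      (fun z j => z (i.succAbove j)) where
  continuous := by fun_prop
  monotone _ _ h _ := h _
  map_point := funext (coface_succAbove i α x)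
  map_comp _ _ _ _ := rfl
  mapsTo z hz j := by simpa using hz (i.succAbove j)
  toReal_eq z hz := by
    have hzi : z i = endpt α := eq_endpt_of_mem_minimalFace hz (coface_same i α x)
    refine .trans (congrArg _ ?_) (toReal_face i α c _).symm
    exact ((coface_eq_iff _ _ _ _).2 ⟨hzi.symm, fun _ => rfl⟩).symm

/- Transports compose along a zigzag of elementary identifications; no normal form of the points of
the realization is needed. -/
theorem exists_isFaceTransport_of_eqvGen {a b : X.PreRealization}
    (h : Relation.EqvGen X.Glue a b) :
    (∃ φ, IsFaceTransport a b φ) ∧ ∃ ψ, IsFaceTransport b a ψ := by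
  induction h with
  | rel _ _ hab =>
    obtain ⟨i, α, c, x⟩ := hab
    exact ⟨⟨_, isFaceTransport_coface i α c x⟩, ⟨_, isFaceTransport_removeNth i α c x⟩⟩
  | refl a => exact ⟨⟨id, .refl a⟩, ⟨id, .refl a⟩⟩
  | symm _ _ _ ih => exact ih.symm
  | trans _ _ _ _ _ ih₁ ih₂ =>
    obtain ⟨⟨φ₁, hφ₁⟩, ⟨ψ₁, hψ₁⟩⟩ := ih₁
    obtain ⟨⟨φ₂, hφ₂⟩, ⟨ψ₂, hψ₂⟩⟩ := ih₂
    exact ⟨⟨_, hφ₂.comp hφ₁⟩, ⟨_, hψ₁.comp hψ₂⟩⟩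

theorem exists_isFaceTransport {m n : ℕ} {c : X.cube m} {x : StdCube m} {b : X.cube n}
    {y : StdCube n} (h : X.toReal c x = X.toReal b y) :
    ∃ φ, IsFaceTransport (X := X) ⟨⟨m, c⟩, x⟩ ⟨⟨n, b⟩, y⟩ φ :=
  (exists_isFaceTransport_of_eqvGen (Quot.eqvGen_exact h)).1

/-! ### The stretching flow on the realization -/

/-- The self-map of the realization that stretches all coordinates by the factor `max 1 r`. -/
noncomputable def stretchRealization (r : ℝ) : X.Realization → X.Realization :=
  Quot.lift (fun a => X.toReal a.1.2 (stretch r ∘ a.2)) <| by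
    rintro _ _ ⟨i, α, c, x⟩
    simp only [toReal_face, coface_comp (stretch_zero r) (stretch_one r)]

@[simp] theorem stretchRealization_toReal (r : ℝ) {n : ℕ} (c : X.cube n) (x : StdCube n) :
    stretchRealization r (X.toReal c x) = X.toReal c (stretch r ∘ x) := rfl

@[simp] theorem stretchRealization_vertexPt (r : ℝ) (v : X.cube 0) :
    stretchRealization r (X.vertexPt v) = X.vertexPt v :=
  congrArg (X.toReal v) (Subsingleton.elim _ _)

theorem stretchRealization_of_le_one {r : ℝ} (hr : r ≤ 1) (x : X.Realization) :
    stretchRealization r x = x := by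
  obtain ⟨n, c, y, rfl⟩ := exists_toReal_eq x
  exact congrArg (X.toReal c) (funext fun j => stretch_of_le_one hr (y j))

theorem stretchRealization_div_stretchRealization {q r : ℝ} (hq : 1 ≤ q) (hqr : q ≤ r)
    (x : X.Realization) :
    stretchRealization (r / q) (stretchRealization q x) = stretchRealization r x := by
  obtain ⟨n, c, y, rfl⟩ := exists_toReal_eq x
  exact congrArg (X.toReal c) (funext fun j => stretch_div_stretch hq hqr (y j))

/- A product of a quotient map with a space need not be a quotient map, so joint continuity is
checked after currying, in the space of flow lines. -/
theorem continuous_stretchRealization :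
    Continuous fun q : ℝ × X.Realization => stretchRealization q.1 q.2 := by
  have hcube (c : Σ n, X.cube n) : Continuous fun q : StdCube c.1 × ℝ =>
      X.toReal c.2 (stretch q.2 ∘ q.1) := by
    refine (continuous_toReal c.2).comp (continuous_pi fun i => ?_)
    simp only [Function.comp_apply]
    fun_prop
  let flowLine : X.Realization → C(ℝ, X.Realization) := fun x => ⟨(stretchRealization · x), by
    obtain ⟨a, rfl⟩ := Quot.exists_rep x
    exact (hcube a.1).comp (.prodMk_right a.2)⟩
  have hflowLine : Continuous flowLine :=
    isQuotientMap_quot_mk.continuous_iff.2 <| continuous_sigma fun c =>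
      ContinuousMap.continuous_of_continuous_uncurry _ (hcube c)
  exact (ContinuousMap.continuous_uncurry_of_continuous ⟨flowLine, hflowLine⟩).comp continuous_swap

/-- The path obtained by stretching all coordinates along `p` by the factor `max 1 r`. -/
noncomputable def stretchPath (r : ℝ) (p : C(I, X.Realization)) : C(I, X.Realization) :=
  ⟨fun t => stretchRealization r (p t),
    continuous_stretchRealization.comp (.prodMk continuous_const p.continuous)⟩

@[simp] theorem stretchPath_apply (r : ℝ) (p : C(I, X.Realization)) (t : I) :
    stretchPath r p t = stretchRealization r (p t) := rfl

theorem stretchPath_of_le_one {r : ℝ} (hr : r ≤ 1) (p : C(I, X.Realization)) :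
    stretchPath r p = p :=
  ContinuousMap.ext fun t => stretchRealization_of_le_one hr (p t)

theorem continuous_stretchPath :
    Continuous fun q : ℝ × C(I, X.Realization) => stretchPath q.1 q.2 := by
  refine ContinuousMap.continuous_of_continuous_uncurry _ ?_
  refine continuous_stretchRealization.comp (f := fun q : (ℝ × C(I, X.Realization)) × I =>
    (q.1.1, q.1.2 q.2)) ?_
  fun_prop

/-- The presentation of `stretchPath r p` obtained by stretching all coordinates. -/
noncomputable def Presentation.stretch {p : C(I, X.Realization)} (P : X.Presentation p) (r : ℝ) :
    X.Presentation (stretchPath r p) where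
  len := P.len
  time := P.time
  time_mono := P.time_mono
  time_zero := P.time_zero
  time_last := P.time_last
  dim := P.dim
  cell := P.cell
  seg i := ⟨fun s j => BoxSet.stretch r (P.seg i s j), by fun_prop⟩
  seg_increasing i j s t h := monotone_stretch r (P.seg_increasing i j s t h)
  eq_seg i s := congrArg (stretchRealization r) (P.eq_seg i s)

theorem IsTame.stretchPath {p : C(I, X.Realization)} (h : X.IsTame p) (r : ℝ) :
    X.IsTame (stretchPath r p) := by
  obtain ⟨P, hP⟩ := h
  refine ⟨P.stretch r, fun i => ?_⟩
  obtain ⟨v, hv⟩ := hP i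
  exact ⟨v, (congrArg _ hv).trans (stretchRealization_vertexPt r v)⟩

theorem IsStrict.stretchPath {p : C(I, X.Realization)} (h : X.IsStrict p) (r : ℝ) :
    X.IsStrict (stretchPath r p) := by
  obtain ⟨P, hP⟩ := h
  refine ⟨P.stretch r, fun i => ⟨(P.stretch r).seg_increasing i, fun j s t hst => ?_⟩⟩
  rcases eq_or_eq_zero_or_eq_one_of_stretch_eq hst with hst | hst
  · rcases (hP i).2 j s t hst with hst | h₀ | h₁
    · exact .inl hst
    · exact .inr (.inl ((congrArg _ h₀).trans (stretch_zero r)))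
    · exact .inr (.inr ((congrArg _ h₁).trans (stretch_one r)))
  · exact .inr hst

/-! ### Lifts to cubes -/

/-- On `[s, t]` the path `p` lifts along `x ↦ [c; x]` to the continuous increasing path `γ`. The
lift is defined on all of `I`, which spares the paths on subintervals. -/
structure IsLift (p : I → X.Realization) {n : ℕ} (c : X.cube n) (γ : I → StdCube n) (s t : I) :
    Prop where
  continuous : Continuous γ
  monotone : Monotone γ
  eq_toReal : ∀ u ∈ Set.Icc s t, p u = X.toReal c (γ u)

section IsLift

variable {p : I → X.Realization} {n : ℕ} {c : X.cube n} {γ δ : I → StdCube n} {s m t : I}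

theorem IsLift.mono (h : IsLift p c γ s t) {s' t' : I} (hs : s ≤ s') (ht : t' ≤ t) :
    IsLift p c γ s' t' :=
  ⟨h.continuous, h.monotone, fun u hu => h.eq_toReal u ⟨hs.trans hu.1, hu.2.trans ht⟩⟩

theorem isLift_const {x : StdCube n} (hp : p s = X.toReal c x) :
    IsLift p c (fun _ => x) s s where
  continuous := continuous_const
  monotone := monotone_const
  eq_toReal u hu := by rwa [le_antisymm hu.2 hu.1]

theorem IsLift.trans (hγ : IsLift p c γ s m) (hδ : IsLift p c δ m t) (h : γ m = δ m) :
    IsLift p c (fun u => if u ≤ m then γ u else δ u) s t where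
  continuous := hγ.continuous.if_le hδ.continuous continuous_id continuous_const
    fun u hu => by rw [hu, h]
  monotone u v huv := by
    dsimp only
    split_ifs with hu hv hv
    · exact hγ.monotone huv
    · exact (hγ.monotone hu).trans (h.le.trans (hδ.monotone (not_le.1 hv).le))
    · exact absurd (huv.trans hv) hu
    · exact hδ.monotone huv
  eq_toReal u hu := by
    split_ifs with hum
    · exact hγ.eq_toReal u ⟨hu.1, hum⟩
    · exact hδ.eq_toReal u ⟨(not_le.1 hum).le, hu.2⟩

theorem IsLift.stretch (h : IsLift p c γ s t) (r : ℝ) :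
    IsLift (stretchRealization r ∘ p) c (fun u => BoxSet.stretch r ∘ γ u) s t where
  continuous := continuous_pi fun j => by
    have := h.continuous
    simp only [Function.comp_apply]
    fun_prop
  monotone _ _ huv j := monotone_stretch r (h.monotone huv j)
  eq_toReal u hu := congrArg (stretchRealization r) (h.eq_toReal u hu)

theorem IsLift.stretch_div {q r : ℝ} (h : IsLift (stretchRealization q ∘ p) c γ s t) (hq : 1 ≤ q)
    (hqr : q ≤ r) :
    IsLift (stretchRealization r ∘ p) c (fun u => BoxSet.stretch (r / q) ∘ γ u) s t := by
  convert h.stretch (r / q) using 1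
  exact funext fun u => (stretchRealization_div_stretchRealization hq hqr (p u)).symm

/- A coordinate that is pushed to `1` at time `s` stays there by monotonicity; the hypothesis
`hzero` does the same for those pushed to `0`. So the stretched lift runs in the minimal face of its
starting point, and can be transported to the cube `b`. -/
theorem IsLift.exists_isLift_stretch {q r : ℝ} (h : IsLift p c γ s t) (hst : s ≤ t) (hq : 1 ≤ q)
    (hqr : q ≤ r) (hzero : ∀ j, BoxSet.stretch q (γ s j) = 0 → BoxSet.stretch r (γ t j) = 0)
    {k : ℕ} {b : X.cube k} {y : StdCube k} (hy : stretchRealization q (p s) = X.toReal b y) :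
    ∃ ε : I → StdCube k, IsLift (stretchRealization r ∘ p) b ε s t ∧
      ε s = BoxSet.stretch (r / q) ∘ y := by
  have hr := h.stretch r
  rw [h.eq_toReal s ⟨le_rfl, hst⟩, stretchRealization_toReal] at hy
  obtain ⟨φ, hφ⟩ := exists_isFaceTransport hy
  have hstart : BoxSet.stretch (r / q) ∘ BoxSet.stretch q ∘ γ s = BoxSet.stretch r ∘ γ s :=
    funext fun j => stretch_div_stretch hq hqr (γ s j)
  have hface (u : I) (hu : u ∈ Set.Icc s t) :
      BoxSet.stretch r ∘ γ u ∈ minimalFace (BoxSet.stretch q ∘ γ s) := by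
    refine fun j => ⟨fun h₀ => ?_, fun h₁ => ?_⟩
    · exact le_antisymm ((hr.monotone hu.2 j).trans (hzero j h₀).le) unitInterval.nonneg'
    · refine le_antisymm unitInterval.le_one' (le_of_eq_of_le ?_ (hr.monotone hu.1 j))
      rw [← hstart, Function.comp_apply, h₁, stretch_one]
  refine ⟨fun u => φ (BoxSet.stretch r ∘ γ u),
    ⟨hφ.continuous.comp hr.continuous, hφ.monotone.comp hr.monotone,
      fun u hu => (hr.eq_toReal u hu).trans (hφ.toReal_eq _ (hface u hu))⟩, ?_⟩
  dsimp only
  rw [← hstart, hφ.map_comp _ (stretch_zero _) (stretch_one _)]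
  exact congrArg _ hφ.map_point

end IsLift

/-- On `[s, t]` the path `p` lifts to some cube. -/
def Seg (p : I → X.Realization) (s t : I) : Prop :=
  s ≤ t ∧ ∃ (n : ℕ) (c : X.cube n) (γ : I → StdCube n), IsLift p c γ s t

theorem Seg.refl (p : I → X.Realization) (s : I) : Seg p s s := by
  obtain ⟨n, c, y, h⟩ := exists_toReal_eq (p s)
  exact ⟨le_rfl, n, c, _, isLift_const h.symm⟩

theorem Seg.clamp {p : I → X.Realization} {u v : I} (h : Seg p u v) (s t : I) :
    Seg p (max s (min u t)) (max s (min v t)) := by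
  by_cases he : max s (min u t) = max s (min v t)
  · rw [he]
    exact Seg.refl p _
  obtain ⟨huv, n, c, γ, hγ⟩ := h
  refine ⟨max_le_max le_rfl (min_le_min huv le_rfl), n, c, γ, hγ.mono ?_ ?_⟩
  · rcases le_total u t with hu | hu
    · exact (min_eq_left hu).ge.trans (le_max_right _ _)
    · exact absurd (by rw [min_eq_right hu, min_eq_right (hu.trans huv)]) he
  · rcases le_total s v with hv | hv
    · exact max_le hv (min_le_left _ _)
    · refine absurd ?_ he
      rw [max_eq_left ((min_le_left _ _).trans hv),
        max_eq_left ((min_le_left _ _).trans (huv.trans hv))]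

/-! ### Short directed paths are pushed into a single cube -/

/-- The sum of the coordinates, modulo `1`: the coordinates lost in a face are integers. -/
noncomputable def coordSum : X.Realization → UnitAddCircle :=
  Quot.lift (fun a => ((∑ j, (a.2 j : ℝ) : ℝ) : UnitAddCircle)) <| by
    rintro _ _ ⟨i, α, c, x⟩
    simp only [Fin.sum_univ_succAbove _ i, coface_same, coface_succAbove, AddCircle.coe_add]
    cases α
    · simp [endpt]
    · simp [endpt, AddCircle.coe_period]

theorem coordSum_toReal {n : ℕ} (c : X.cube n) (x : StdCube n) :
    coordSum (X.toReal c x) = ((∑ j, (x j : ℝ) : ℝ) : UnitAddCircle) := rfl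

@[fun_prop]
theorem continuous_coordSum : Continuous (coordSum (X := X)) := by
  refine continuous_quot_lift _ (continuous_sigma fun c => ?_)
  have : Continuous fun x : StdCube c.1 => ∑ j, (x j : ℝ) := by fun_prop
  exact (AddCircle.continuous_mk' 1).comp this

/-- The sum of the coordinates rises by `a`, modulo `1`, along `p` from `s` to `t`, and after
stretching by the factor `(1 - 2 * a)⁻¹`, which pushes the coordinates at most `a` to `0`, the path
lifts to a single cube on `[s, t]`. -/
def IsPushed (p : I → X.Realization) (s t : I) (a : ℝ) : Prop :=
  coordSum (p t) - coordSum (p s) = (a : UnitAddCircle) ∧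
    Seg (stretchRealization (1 - 2 * a)⁻¹ ∘ p) s t

theorem IsLift.exists_add_of_norm_lt {p : I → X.Realization} {n : ℕ} {c : X.cube n}
    {γ : I → StdCube n} {s t : I} (h : IsLift p c γ s t) (hst : s ≤ t) {x : UnitAddCircle} {a ε : ℝ}
    (hε : ε ≤ 1 / 2) (ha : a < ε) (hx : coordSum (p s) - x = (a : UnitAddCircle))
    (hp : ∀ u ∈ Set.Icc s t, ‖coordSum (p u) - x‖ < ε) :
    ∃ b < ε, coordSum (p t) - x = (b : UnitAddCircle) ∧ a ≤ b ∧
      ∀ j, (γ t j : ℝ) ≤ γ s j + (b - a) := by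
  let rise (u : I) : ℝ := ∑ j, ((γ u j : ℝ) - γ s j)
  have hcont : Continuous rise := by
    have := h.continuous
    fun_prop
  have hrise (u : I) (hu : u ∈ Set.Icc s t) :
      coordSum (p u) - x = ((a + rise u : ℝ) : UnitAddCircle) := by
    rw [AddCircle.coe_add, ← hx, h.eq_toReal u hu, h.eq_toReal s ⟨le_rfl, hst⟩]
    simp only [rise, coordSum_toReal, Finset.sum_sub_distrib, AddCircle.coe_sub]
    abel
  have hnonneg (j : Fin n) : 0 ≤ (γ t j : ℝ) - γ s j := sub_nonneg.2 (h.monotone hst j)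
  refine ⟨a + rise t, ?_, hrise t ⟨hst, le_rfl⟩, ?_, fun j => ?_⟩
  · refine lt_of_norm_coe_lt_of_isPreconnected isPreconnected_Icc (φ := fun u => a + rise u)
      (by fun_prop) hε (fun u hu => ?_) (Set.left_mem_Icc.2 hst) (Set.right_mem_Icc.2 hst) ?_
    · rw [← hrise u hu]
      exact hp u hu
    · simpa [rise] using ha
  · exact le_add_of_nonneg_right (Finset.sum_nonneg fun j _ => hnonneg j)
  · have := Finset.single_le_sum (fun j _ => hnonneg j) (Finset.mem_univ j)
    simp only [rise]
    linarith

theorem IsPushed.extend {p : I → X.Realization} {s m t : I} {a : ℝ} (ha₀ : 0 ≤ a)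
    (ha : a < 1 / 4) (h : IsPushed p s m a) (hmt : Seg p m t)
    (hp : ∀ u ∈ Set.Icc s t, ‖coordSum (p u) - coordSum (p s)‖ < 1 / 4) :
    ∃ b ∈ Set.Ico (0 : ℝ) (1 / 4), IsPushed p s t b := by
  obtain ⟨hS, hsm, n, c, γ, hγ⟩ := h
  obtain ⟨hmt, k, e, β, hβ⟩ := hmt
  obtain ⟨b, hb, hSb, hab, hβb⟩ := hβ.exists_add_of_norm_lt hmt (by norm_num) ha hS
    fun u hu => hp u ⟨hsm.trans hu.1, hu.2⟩
  have hq : 1 ≤ (1 - 2 * a)⁻¹ := (one_le_inv₀ (by linarith)).2 (by linarith)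
  have hqr : (1 - 2 * a)⁻¹ ≤ (1 - 2 * b)⁻¹ := inv_anti₀ (by linarith) (by linarith)
  have hzero (j) (hj : stretch (1 - 2 * a)⁻¹ (β m j) = 0) : stretch (1 - 2 * b)⁻¹ (β t j) = 0 := by
    rw [stretch_inv_eq_zero_iff (by linarith) (by linarith)] at hj ⊢
    linarith [hβb j]
  obtain ⟨δ, hδ, hδm⟩ := hβ.exists_isLift_stretch hmt hq hqr hzero (hγ.eq_toReal m ⟨hsm, le_rfl⟩)
  exact ⟨b, ⟨ha₀.trans hab, hb⟩, hSb, hsm.trans hmt, n, c, _,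
    (hγ.stretch_div hq hqr).trans hδ hδm.symm⟩

theorem exists_isPushed {p : I → X.Realization} {s t : I}
    (h : Relation.ReflTransGen (Seg p) s t)
    (hp : ∀ u ∈ Set.Icc s t, ‖coordSum (p u) - coordSum (p s)‖ < 1 / 4) :
    ∃ a ∈ Set.Ico (0 : ℝ) (1 / 4), IsPushed p s t a := by
  induction h with
  | refl => exact ⟨0, by norm_num, by simp, Seg.refl _ _⟩
  | tail _ hmt ih =>
    obtain ⟨a, ha, hpush⟩ := ih fun u hu => hp u ⟨hu.1, hu.2.trans hmt.1⟩
    exact hpush.extend ha.1 ha.2 hmt hp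

theorem seg_stretchRealization_inv {p : I → X.Realization} {s t : I}
    (h : Relation.ReflTransGen (Seg p) s t)
    (hp : ∀ u ∈ Set.Icc s t, ‖coordSum (p u) - coordSum (p s)‖ < 1 / 4) {w : ℝ} (hw₀ : 0 < w)
    (hw : w ≤ 1 / 2) : Seg (stretchRealization w⁻¹ ∘ p) s t := by
  obtain ⟨a, ⟨ha₀, ha⟩, -, hst, n, c, γ, hγ⟩ := exists_isPushed h hp
  exact ⟨hst, n, c, _, hγ.stretch_div ((one_le_inv₀ (by linarith)).2 (by linarith))
    (inv_anti₀ hw₀ (by linarith))⟩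

/-! ### Presentations as chains of segments -/

theorem Presentation.seg_time {p : C(I, X.Realization)} (P : X.Presentation p) (i : Fin P.len) :
    Seg p (P.time i.castSucc) (P.time i.succ) := by
  have h : P.time i.castSucc ≤ P.time i.succ := P.time_mono i.castSucc_lt_succ.le
  refine ⟨h, P.dim i, P.cell i, fun u => P.seg i (Set.projIcc _ _ h u), by fun_prop,
    fun u v huv j => P.seg_increasing i j _ _ (Set.monotone_projIcc h huv), fun u hu => ?_⟩
  simp only [Set.projIcc_of_mem h hu]
  exact P.eq_seg i ⟨u, hu⟩

theorem Presentation.reflTransGen_seg {p : C(I, X.Realization)} (P : X.Presentation p) :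
    Relation.ReflTransGen (Seg p) 0 1 := by
  have h (k : Fin (P.len + 1)) : Relation.ReflTransGen (Seg p) 0 (P.time k) := by
    induction k using Fin.induction with
    | zero => rw [P.time_zero]
    | succ i ih => exact ih.tail (P.seg_time i)
  exact P.time_last ▸ h (Fin.last _)

theorem Presentation.reflTransGen_seg_of_le {p : C(I, X.Realization)} (P : X.Presentation p)
    {s t : I} (hst : s ≤ t) : Relation.ReflTransGen (Seg p) s t := by
  have := P.reflTransGen_seg.lift (p := Seg p) (fun u => max s (min u t))
    fun u v h => Seg.clamp h s t
  simpa only [Function.onFun, min_eq_left (unitInterval.nonneg' : 0 ≤ t),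
    min_eq_right (unitInterval.le_one' : t ≤ 1), max_eq_left (unitInterval.nonneg' : 0 ≤ s),
    max_eq_right hst] using this

theorem Presentation.eq_zero_or_exists_mem {p : C(I, X.Realization)} (P : X.Presentation p)
    (u : I) : u = 0 ∨ ∃ i : Fin P.len, u ∈ Set.Icc (P.time i.castSucc) (P.time i.succ) := by
  have h (k : Fin (P.len + 1)) : u ≤ P.time k →
      u = 0 ∨ ∃ i : Fin P.len, u ∈ Set.Icc (P.time i.castSucc) (P.time i.succ) := by
    induction k using Fin.induction with
    | zero => exact fun h => .inl (le_antisymm (P.time_zero ▸ h) u.2.1)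
    | succ i ih =>
      intro hi
      rcases le_total u (P.time i.castSucc) with h | h
      · exact ih h
      · exact .inr ⟨i, h, hi⟩
  exact h (Fin.last _) (P.time_last ▸ u.2.2)

/-- A point of the realization is a vertex. -/
def IsVertex (x : X.Realization) : Prop := ∃ v, x = X.vertexPt v

theorem IsVertex.stretchRealization {x : X.Realization} (h : IsVertex x) (r : ℝ) :
    IsVertex (stretchRealization r x) := by
  obtain ⟨v, rfl⟩ := h
  exact ⟨v, stretchRealization_vertexPt r v⟩

theorem isTame_of_reflTransGen {p : C(I, X.Realization)} (h₀ : IsVertex (p 0))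
    (h : Relation.ReflTransGen (fun s t => Seg p s t ∧ IsVertex (p t)) 0 1) : X.IsTame p := by
  obtain ⟨τ, hτ₀, hτ₁⟩ := exists_relSeries_of_reflTransGen h
  choose hle n c γ hγ using fun i => (τ.step i).1
  let P : X.Presentation p :=
    { len := τ.length
      time := τ
      time_mono := Fin.monotone_iff_le_succ.2 hle
      time_zero := hτ₀
      time_last := hτ₁
      dim := n
      cell := c
      seg i := ⟨fun u => γ i u, (hγ i).continuous.comp continuous_subtype_val⟩
      seg_increasing i j s t hst := (hγ i).monotone hst j
      eq_seg i s := (hγ i).eq_toReal s s.2 }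
  refine ⟨P, fun i => ?_⟩
  induction i using Fin.cases with
  | zero => rwa [P.time_zero]
  | succ i => exact (τ.step i).2

/-! ### Stretching away from the centre -/

theorem isVertex_toReal {n : ℕ} (c : X.cube n) (x : StdCube n) (hx : ∀ j, x j = 0 ∨ x j = 1) :
    IsVertex (X.toReal c x) := by
  induction n with
  | zero => exact ⟨c, congrArg _ (Subsingleton.elim _ _)⟩
  | succ n ih =>
    obtain ⟨α, hα⟩ : ∃ α, endpt α = x 0 := by
      rcases hx 0 with h | h
      · exact ⟨false, h.symm⟩
      · exact ⟨true, h.symm⟩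
    have hface : coface 0 α (fun j => x (Fin.succAbove 0 j)) = x :=
      (coface_eq_iff _ _ _ _).2 ⟨hα, fun _ => rfl⟩
    rw [← hface, ← toReal_face]
    exact ih _ _ fun j => hx _

/-- The product of the normalized distances of the coordinates from the centre of the interval. The
coordinates lost in a face contribute the factor `1`. -/
noncomputable def centreDist : X.Realization → ℝ :=
  Quot.lift (fun a => ∏ j, |2 * (a.2 j : ℝ) - 1|) <| by
    rintro _ _ ⟨i, α, c, x⟩
    simp only [Fin.prod_univ_succAbove _ i, coface_same, coface_succAbove]
    cases α <;> norm_num [endpt]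

theorem centreDist_toReal {n : ℕ} (c : X.cube n) (x : StdCube n) :
    centreDist (X.toReal c x) = ∏ j, |2 * (x j : ℝ) - 1| := rfl

@[fun_prop]
theorem continuous_centreDist : Continuous (centreDist (X := X)) :=
  continuous_quot_lift _ <| continuous_sigma fun c =>
    (by fun_prop : Continuous fun x : StdCube c.1 => ∏ j, |2 * (x j : ℝ) - 1|)

theorem centreDist_nonneg (x : X.Realization) : 0 ≤ centreDist x := by
  obtain ⟨n, c, y, rfl⟩ := exists_toReal_eq x
  exact Finset.prod_nonneg fun _ _ => abs_nonneg _

theorem centreDist_toReal_le {n : ℕ} (c : X.cube n) (x : StdCube n) (j : Fin n) :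
    centreDist (X.toReal c x) ≤ |2 * (x j : ℝ) - 1| := by
  rw [centreDist_toReal, ← Finset.mul_prod_erase _ _ (Finset.mem_univ j)]
  refine mul_le_of_le_one_right (abs_nonneg _) (Finset.prod_le_one (fun _ _ => abs_nonneg _) ?_)
  exact fun k _ => abs_le.2 ⟨by linarith [(x k).2.1], by linarith [(x k).2.2]⟩

theorem isVertex_stretchRealization_inv {x : X.Realization} {w : ℝ} (hw₀ : 0 < w) (hw₁ : w ≤ 1)
    (hx : w ≤ centreDist x) : IsVertex (stretchRealization w⁻¹ x) := by
  obtain ⟨n, c, y, rfl⟩ := exists_toReal_eq x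
  refine isVertex_toReal c _ fun j => ?_
  rw [Function.comp_apply, stretch_inv_eq_zero_iff hw₀ hw₁, stretch_inv_eq_one_iff hw₀ hw₁]
  rcases le_abs.1 (hx.trans (centreDist_toReal_le c y j)) with h | h
  · exact .inr (by linarith)
  · exact .inl (by linarith)

theorem StrictlyIncreasing.subsingleton_centre {n : ℕ} {J : Set I} {b : C(J, StdCube n)}
    (hb : StrictlyIncreasing b) (j : Fin n) : {u : J | |2 * (b u j : ℝ) - 1| = 0}.Subsingleton := by
  intro u hu v hv
  have hu' : (b u j : ℝ) = 1 / 2 := by linarith [abs_eq_zero.1 hu]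
  have hv' : (b v j : ℝ) = 1 / 2 := by linarith [abs_eq_zero.1 hv]
  rcases hb.2 j u v (Subtype.ext (hu'.trans hv'.symm)) with h | h | h
  · exact h
  · norm_num [h] at hu'
  · norm_num [h] at hu'

theorem IsStrict.finite_centreDist_eq_zero {p : C(I, X.Realization)} (h : X.IsStrict p) :
    {u : I | centreDist (p u) = 0}.Finite := by
  obtain ⟨P, hP⟩ := h
  let S (i : Fin P.len) (j : Fin (P.dim i)) :
      Set (Set.Icc (P.time i.castSucc) (P.time i.succ)) := {u | |2 * (P.seg i u j : ℝ) - 1| = 0}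
  have hfinite : ({0} ∪ ⋃ i, ⋃ j, Subtype.val '' S i j).Finite :=
    (Set.finite_singleton 0).union <| Set.finite_iUnion fun i => Set.finite_iUnion fun j =>
      ((hP i).subsingleton_centre j).finite.image _
  refine hfinite.subset fun u (hu : centreDist (p u) = 0) => ?_
  rcases P.eq_zero_or_exists_mem u with h | ⟨i, hi⟩
  · exact .inl h
  · rw [P.eq_seg i ⟨u, hi⟩, centreDist_toReal, Finset.prod_eq_zero_iff] at hu
    obtain ⟨j, _, hj⟩ := hu
    exact .inr (Set.mem_iUnion₂.2 ⟨i, j, ⟨u, hi⟩, hj, rfl⟩)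

theorem IsStrict.dense_centreDist_pos {p : C(I, X.Realization)} (h : X.IsStrict p) :
    Dense {u : I | 0 < centreDist (p u)} :=
  (dense_univ.sdiff_finite h.finite_centreDist_eq_zero).mono fun _ hu =>
    (centreDist_nonneg _).lt_of_ne' hu.2

/-! ### The scale of a path -/

/-- A modulus of continuity of `p`: at distance less than `oscScale p`, the values of `coordSum`
along `p` differ by less than `1 / 4`. -/
noncomputable def oscScale (p : C(I, X.Realization)) : ℝ :=
  ⨅ q : I × I, max (dist q.1 q.2) (1 / 4 - ‖coordSum (p q.1) - coordSum (p q.2)‖)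

theorem continuous_oscScale : Continuous (oscScale (X := X)) :=
  continuous_iInf_of_compactSpace (f := fun (p : C(I, X.Realization)) (q : I × I) =>
    max (dist q.1 q.2) (1 / 4 - ‖coordSum (p q.1) - coordSum (p q.2)‖)) (by fun_prop)

theorem oscScale_le (p : C(I, X.Realization)) (s t : I) :
    oscScale p ≤ max (dist s t) (1 / 4 - ‖coordSum (p s) - coordSum (p t)‖) :=
  ciInf_le (isCompact_range (by fun_prop)).bddBelow (s, t)

theorem oscScale_le_one_fourth (p : C(I, X.Realization)) : oscScale p ≤ 1 / 4 := by
  simpa using oscScale_le p 0 0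

theorem oscScale_pos (p : C(I, X.Realization)) : 0 < oscScale p := by
  obtain ⟨⟨s, t⟩, h⟩ := exists_eq_iInf_of_compactSpace (f := fun q : I × I =>
    max (dist q.1 q.2) (1 / 4 - ‖coordSum (p q.1) - coordSum (p q.2)‖)) (by fun_prop)
  rw [oscScale, ← h]
  rcases eq_or_ne s t with rfl | hst
  · simp
  · exact lt_max_of_lt_left (dist_pos.2 hst)

theorem norm_coordSum_sub_lt {p : C(I, X.Realization)} {s t : I} (h : dist s t < oscScale p) :
    ‖coordSum (p s) - coordSum (p t)‖ < 1 / 4 := by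
  have := (lt_max_iff.1 (h.trans_le (oscScale_le p s t))).resolve_left (lt_irrefl _)
  linarith [dist_nonneg (x := s) (y := t)]

/-- The minimum over `t` of the best compromise between coordinates far from the centre and times
close to `t`: if `0 < tameRadius p`, then within `oscScale p / 4` of every `t` there is a time `u`
with `tameRadius p ≤ centreDist (p u)`. -/
noncomputable def tameRadius (p : C(I, X.Realization)) : ℝ :=
  ⨅ t : I, ⨆ u : I, min (centreDist (p u)) (oscScale p - 4 * dist u t)

theorem continuous_tameRadius : Continuous (tameRadius (X := X)) := by
  have := continuous_oscScale (X := X)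
  refine continuous_iInf_of_compactSpace (continuous_iSup_of_compactSpace
    (f := fun (q : C(I, X.Realization) × I) (u : I) =>
      min (centreDist (q.1 u)) (oscScale q.1 - 4 * dist u q.2)) ?_)
  fun_prop

theorem exists_tameRadius_le (p : C(I, X.Realization)) (t : I) :
    ∃ u, tameRadius p ≤ min (centreDist (p u)) (oscScale p - 4 * dist u t) := by
  obtain ⟨u, hu⟩ := exists_eq_iSup_of_compactSpace (f := fun u : I =>
    min (centreDist (p u)) (oscScale p - 4 * dist u t)) (by fun_prop)
  refine ⟨u, hu ▸ ciInf_le (isCompact_range ?_).bddBelow t⟩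
  exact continuous_iSup_of_compactSpace (f := fun t u : I =>
    min (centreDist (p u)) (oscScale p - 4 * dist u t)) (by fun_prop)

theorem tameRadius_le_one_fourth (p : C(I, X.Realization)) : tameRadius p ≤ 1 / 4 := by
  obtain ⟨u, hu⟩ := exists_tameRadius_le p 0
  have := (le_min_iff.1 hu).2
  linarith [oscScale_le_one_fourth p, dist_nonneg (x := u) (y := 0)]

theorem IsStrict.tameRadius_pos {p : C(I, X.Realization)} (h : X.IsStrict p) :
    0 < tameRadius p := by
  let f (t u : I) : ℝ := min (centreDist (p u)) (oscScale p - 4 * dist u t)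
  obtain ⟨t, ht⟩ := exists_eq_iInf_of_compactSpace (f := fun t => ⨆ u, f t u)
    (continuous_iSup_of_compactSpace (by fun_prop))
  obtain ⟨u, hu, hut⟩ := h.dense_centreDist_pos.exists_dist_lt t
    (show 0 < oscScale p / 4 by linarith [oscScale_pos p])
  have hf : 0 < f t u := lt_min hu (by rw [dist_comm]; linarith)
  exact hf.trans_le ((le_ciSup (isCompact_range (by fun_prop)).bddAbove u).trans_eq ht)

/-! ### The deformation -/

theorem Presentation.seg_stretchPath_inv {p : C(I, X.Realization)} (P : X.Presentation p) {w : ℝ}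
    (hw₀ : 0 < w) (hw : w ≤ 1 / 2) {s t : I} (hst : s ≤ t) (h : (t : ℝ) - s < oscScale p) :
    Seg (stretchPath w⁻¹ p) s t := by
  refine seg_stretchRealization_inv (P.reflTransGen_seg_of_le hst) (fun u hu => ?_) hw₀ hw
  refine norm_coordSum_sub_lt (lt_of_le_of_lt ?_ h)
  have hsu : (s : ℝ) ≤ u := hu.1
  have hut : (u : ℝ) ≤ t := hu.2
  rw [Subtype.dist_eq, Real.dist_eq, abs_of_nonneg (by linarith)]
  linarith

theorem Presentation.isTame_stretchPath_inv_tameRadius {p : C(I, X.Realization)}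
    (P : X.Presentation p) (hp : 0 < tameRadius p) (h₀ : IsVertex (p 0)) (h₁ : IsVertex (p 1)) :
    X.IsTame (stretchPath (tameRadius p)⁻¹ p) := by
  have hw := tameRadius_le_one_fourth p
  have hosc := oscScale_pos p
  have hseg {s t : I} := P.seg_stretchPath_inv hp (by linarith) (s := s) (t := t)
  refine isTame_of_reflTransGen (h₀.stretchRealization _)
    (reflTransGen_one_of_step (div_pos hosc four_pos) (fun s => ?_) 0)
  by_cases hs : 1 - (s : ℝ) < oscScale p
  · exact .inl ⟨hseg unitInterval.le_one' hs, h₁.stretchRealization _⟩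
  let m : I := ⟨s + oscScale p / 2, by linarith [s.2.1], by linarith⟩
  obtain ⟨t, ht⟩ := exists_tameRadius_le p m
  obtain ⟨hDt, hmt⟩ := le_min_iff.1 ht
  have htm : |(t : ℝ) - (s + oscScale p / 2)| < oscScale p / 4 := by
    rw [← Real.dist_eq]
    change dist t m < _
    linarith
  obtain ⟨hlower, hupper⟩ := abs_lt.1 htm
  have hst : s ≤ t := Subtype.coe_le_coe.1 (by linarith)
  exact .inr ⟨t, by linarith, hseg hst (by linarith),
    isVertex_stretchRealization_inv hp (by linarith) hDt⟩

theorem stretchPath_mem_strictPaths {x y : X.cube 0} {p : C(I, X.Realization)}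
    (hp : p ∈ X.strictPaths x y) (r : ℝ) : stretchPath r p ∈ X.strictPaths x y :=
  ⟨hp.1.stretchPath r, by simp [hp.2.1], by simp [hp.2.2]⟩

theorem stretchPath_inv_tameRadius_mem_strictTamePaths {x y : X.cube 0} {p : C(I, X.Realization)}
    (hp : p ∈ X.strictPaths x y) : stretchPath (tameRadius p)⁻¹ p ∈ X.strictTamePaths x y := by
  obtain ⟨P, -⟩ := hp.1
  have hstretch := stretchPath_mem_strictPaths hp (tameRadius p)⁻¹
  exact ⟨⟨hstretch.1, P.isTame_stretchPath_inv_tameRadius hp.1.tameRadius_pos ⟨x, hp.2.1⟩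
    ⟨y, hp.2.2⟩⟩, hstretch.2⟩

/-- The deformation of strict paths to tame ones: at time `s` the path `p` is stretched by the
factor `max 1 (s / tameRadius p)`. -/
noncomputable def tameDeformation (X : BoxSet.{u}) (x y : X.cube 0) :
    C(I × X.strictPaths x y, X.strictPaths x y) where
  toFun q := ⟨stretchPath (q.1 / tameRadius q.2.1) q.2, stretchPath_mem_strictPaths q.2.2 _⟩
  continuous_toFun := by
    refine .subtype_mk (continuous_stretchPath.comp (.prodMk ?_ (by fun_prop))) _
    exact .div (by fun_prop) (continuous_tameRadius.comp (by fun_prop))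
      fun q => q.2.2.1.tameRadius_pos.ne'

theorem coe_tameDeformation {x y : X.cube 0} (s : I) (p : X.strictPaths x y) :
    (X.tameDeformation x y (s, p) : C(I, X.Realization)) = stretchPath (s / tameRadius p.1) p := rfl

end BoxSet

theorem mainTheorem2 (X : BoxSet.{u}) (xminus xplus : X.cube 0) :
    IsHomotopyEquivalence (X.tameInclusion xminus xplus) := by
  refine isHomotopyEquivalence_inclusion (X.strictTamePaths_subset xminus xplus)
    (X.tameDeformation xminus xplus) (fun p => Subtype.ext ?_) (fun p => ?_) fun s p hp => ?_
  · rw [BoxSet.coe_tameDeformation]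
    exact BoxSet.stretchPath_of_le_one (by simp) _
  · rw [BoxSet.coe_tameDeformation, Set.Icc.coe_one, one_div]
    exact BoxSet.stretchPath_inv_tameRadius_mem_strictTamePaths p.2
  · have hs := (X.tameDeformation xminus xplus (s, p)).2
    exact ⟨⟨hs.1, hp.1.2.stretchPath _⟩, hs.2⟩
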